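/- Let $\mathcal A\subset\mathbb Z^d$ be a finite set whose convex hull $\Delta$ has dimension $d$, and let $w=(w_{\mathbf a})_{\mathbf a\in\mathcal A}$ be positive real weights. Identify the set of points of $\mathbb{RP}^{\mathcal A}$ with non-negative coordinates with the probability simplex in $\mathbb R^{\mathcal A}$ via $[p]\mapsto p/|p|$, $|p|=\sum_{\mathbf a}p_{\mathbf a}$. Let $X_{\mathcal A,w}$ be the closure of $\{[w_{\mathbf a}x^{\mathbf a}]_{\mathbf a\in\mathcal A}\mid x\in\mathbb R^d_{>}\}$, and let $\pi_{\mathcal A}(p)=\sum_{\mathbf a}p_{\mathbf a}\mathbf a\,/\sum_{\mathbf a}p_{\mathbf a}$ be the tautological projection. A patch is a family $\beta=(\beta_{\mathbf a})_{\mathbf a\in\mathcal A}$ of continuous non-negative functions on $\Delta$ without common zero; it is a toric patch of shape $(\mathcal A,w)$ if $\{[\beta(x)]\mid x\in\Delta\}=X_{\mathcal A,w}$; it is proper if $x\mapsto\pi_{\mathcal A}(\beta(x))$ is a homeomorphism of $\Delta$; and it has linear precision if $\Lambda(x)=\sum_{\mathbf a}\beta_{\mathbf a}(x)\Lambda(\mathbf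 a)$ for every affine function $\Lambda$ on $\mathbb R^d$ and every $x\in\Delta$. Iterative proportional fitting at $y\in\Delta$ is the following algorithm. Choose $\mathbf b\in\mathbb R^d$ and $t>0$ such that $t(\mathbf a+\mathbf b)$ has non-negative coordinates with sum at most $1$ for every $\mathbf a\in\mathcal A$; such a choice exists. For $z\in\mathbb R^d$ put $z^+=(1-|z'|,z')\in\mathbb R^{1+d}$, where $z'=t(z+\mathbf b)$. Set $p^{(0)}=w$ and $$p^{(n+1)}_{\mathbf a}=p^{(n)}_{\mathbf a}\,\frac{(y^+)^{\mathbf a^+}}{\bigl(\sum_{\mathbf c\in\mathcal A}p^{(n)}_{\mathbf c}\,\mathbf c^+\bigr)^{\mathbf a^+}}\qquad(n\ge0),$$ where $u^{v}=\prod_i u_i^{v_i}$, $0^0=1$, and a coordinate $p_{\mathbf a}$ that has become $0$ stays $0$. Then: 1. $\pi_{\mathcal A}$ restricts to a homeomorphism from $X_{\mathcal A,w}$ onto $\Delta$, and iterative proportional fitting computes its inverse: for every $y\in\Delta$ and every admissible choice of $\mathbf b,t$, the sequence $p^{(n)}$ converges in $\mathbb R^{\mathcal A}$ to the unique point $\pi_{\mathcal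 A}^{-1}(y)$ of $X_{\mathcal A,w}$ that $\pi_{\mathcal A}$ maps to $y$. If in the algorithm $\sum_{\mathbf c}p^{(n)}_{\mathbf c}\mathbf c^+$ is replaced by $\sum_{\mathbf c}p^{(n)}_{\mathbf c}\mathbf c^+/\sum_{\mathbf c}p^{(n)}_{\mathbf c}$, then $p^{(n)}/|p^{(n)}|$ converges to the same point. 2. The coordinates of the limit $y\mapsto\pi_{\mathcal A}^{-1}(y)$ form a toric patch of shape $(\mathcal A,w)$ with linear precision, and this is the only toric patch of shape $(\mathcal A,w)$ with linear precision. Moreover, for every proper toric patch $\beta$ of shape $(\mathcal A,w)$ there is exactly one homeomorphism $\psi$ of $\Delta$ such that the normalization of $\beta\circ\psi$ has linear precision, and this normalization is $\pi_{\mathcal A}^{-1}$. -/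

import Mathlib

open Set Filter Topology

noncomputable section

namespace ToricPatch

/-- The representative with coordinate sum `1` of the point `[p]` of projective space;
non-negative projective space is identified in this way with the probability simplex. -/
def normalize {ι : Type*} [Fintype ι] (p : ι → ℝ) : ι → ℝ :=
  (∑ a, p a)⁻¹ • p

/-- The linear projection given by control points `v`, applied to the vector `p` without
normalization: `∑ p_a v_a`. -/
def linProj {ι κ : Type*} [Fintype ι] (v : ι → κ → ℝ) (p : ι → ℝ) : κ → ℝ :=
  ∑ a, p a • v a

/-- The tautological projection of the configuration `v`, in affine coordinates: the projective
point represented by `∑ p_a (1, v_a)` is `(∑ p_a v_a) / (∑ p_a)`. -/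
def tautProj {ι κ : Type*} [Fintype ι] (v : ι → κ → ℝ) (p : ι → ℝ) : κ → ℝ :=
  (∑ a, p a)⁻¹ • linProj v p

/-- The monomial `y ^ e = ∏ y_i ^ e_i` with real exponents (with `0 ^ 0 = 1`). -/
def monom {κ : Type*} [Fintype κ] (y e : κ → ℝ) : ℝ :=
  ∏ i, y i ^ e i

/-- The points of `A`, as points of real space. -/
def pts {d : ℕ} (A : Finset (Fin d → ℤ)) : A → Fin d → ℝ :=
  fun a i => (a.1 i : ℝ)

/-- The domain polytope, the convex hull of `A`. -/
def polytope {d : ℕ} (A : Finset (Fin d → ℤ)) : Set (Fin d → ℝ) :=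
  convexHull ℝ (range (pts A))

/-- The monomial parametrization `x ↦ (w_a x ^ a)`. -/
def monomMap {d : ℕ} (A : Finset (Fin d → ℤ)) (w : A → ℝ) (x : Fin d → ℝ) : A → ℝ :=
  fun a => w a * ∏ i, x i ^ (a.1 i)

/-- The non-negative toric variety `X_{A,w}` inside the probability simplex: the closure of the
image of the positive orthant under the monomial parametrization. -/
def toricVariety {d : ℕ} (A : Finset (Fin d → ℤ)) (w : A → ℝ) : Set (A → ℝ) :=
  closure ((fun x => normalize (monomMap A w x)) '' {x : Fin d → ℝ | ∀ i, 0 < x i})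

/-- A patch: non-negative continuous blending functions on the polytope that have no common
zero. -/
structure IsPatch {d : ℕ} (A : Finset (Fin d → ℤ)) (β : polytope A → A → ℝ) : Prop where
  continuous : Continuous β
  nonneg : ∀ x a, 0 ≤ β x a
  no_base_point : ∀ x, ∃ a, β x a ≠ 0

/-- A toric patch of shape `(A, w)`: a patch whose image in (non-negative) projective space is
`X_{A,w}`. -/
structure IsToricPatch {d : ℕ} (A : Finset (Fin d → ℤ)) (w : A → ℝ)
    (β : polytope A → A → ℝ) : Prop extends IsPatch A β where
  image_eq : range (fun x => normalize (β x)) = toricVariety A w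

/-- Linear precision: the blending functions replicate all affine functions. (For constant
functions this says that they are normalized.) -/
def HasLinearPrecision {d : ℕ} (A : Finset (Fin d → ℤ)) (β : polytope A → A → ℝ) : Prop :=
  ∀ Λ : (Fin d → ℝ) →ᵃ[ℝ] ℝ, ∀ x : polytope A, Λ x = ∑ a, β x a * Λ (pts A a)

/-- A patch is proper if its tautological map is a homeomorphism of the polytope. -/
def IsProper {d : ℕ} (A : Finset (Fin d → ℤ)) (β : polytope A → A → ℝ) : Prop :=
  ∃ τ : polytope A ≃ₜ polytope A, ∀ x, (τ x : Fin d → ℝ) = tautProj (pts A) (β x)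

/-- The simplex `x ≥ 0`, `∑ x_i ≤ 1` in real `d`-space. -/
def solidSimplex (d : ℕ) : Set (Fin d → ℝ) :=
  {x | (∀ i, 0 ≤ x i) ∧ ∑ i, x i ≤ 1}

/-- Translation by `b` followed by scaling by `t` moves `A` into the solid simplex. -/
def IsNormalizing {d : ℕ} (A : Finset (Fin d → ℤ)) (b : Fin d → ℝ) (t : ℝ) : Prop :=
  0 < t ∧ ∀ a : A, t • (pts A a + b) ∈ solidSimplex d

/-- The affine map `y ↦ (1 - |y'|, y')`, where `y' = t (y + b)`. -/
def homog {d : ℕ} (b : Fin d → ℝ) (t : ℝ) (y : Fin d → ℝ) : Fin (d + 1) → ℝ :=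
  Fin.cons (1 - ∑ i, (t • (y + b)) i) (t • (y + b))

/-- The iteration `p_a ↦ p_a * y ^ {v_a} / (proj p) ^ {v_a}` started at `w`. -/
def scalingIter {ι κ : Type*} [Fintype κ] (proj : (ι → ℝ) → κ → ℝ) (v : ι → κ → ℝ)
    (w : ι → ℝ) (y : κ → ℝ) : ℕ → ι → ℝ
  | 0 => w
  | n + 1 => fun a =>
      scalingIter proj v w y n a *
        (monom y (v a) / monom (proj (scalingIter proj v w y n)) (v a))

/-- Iterative proportional fitting for `(A, w)` at `y`, run in the homogeneous form of `A` given
by `(b, t)`, with the tautological projection in affine coordinates. -/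
def ipf {d : ℕ} (A : Finset (Fin d → ℤ)) (w : A → ℝ) (b : Fin d → ℝ) (t : ℝ)
    (y : Fin d → ℝ) : ℕ → A → ℝ :=
  scalingIter (tautProj fun a => homog b t (pts A a)) (fun a => homog b t (pts A a)) w
    (homog b t y)

/-- The Darroch–Ratcliff generalized iterative scaling: the same iteration, with the
projection `∑ p_a a` of the vector `p` itself in place of its affine normalization. -/
def gis {d : ℕ} (A : Finset (Fin d → ℤ)) (w : A → ℝ) (b : Fin d → ℝ) (t : ℝ)
    (y : Fin d → ℝ) : ℕ → A → ℝ :=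
  scalingIter (linProj fun a => homog b t (pts A a)) (fun a => homog b t (pts A a)) w
    (homog b t y)

end ToricPatch

end

/-! The map `linProj` is continuous from the compact set `X_{A,w}` to the polytope, so it is a
homeomorphism once it is bijective. Injectivity is Birch's argument. On the torus, `log (p/w)` is an
affine function of `a`, and this survives on the closure as binomial equations with real exponents.
If `p` and `q` in `X_{A,w}` have the same projection, then `p - q` is an affine relation, so it
pairs to zero with `log (p/w)` and with `log (q/w)`. Hence `∑ (p_a - q_a)(log p_a - log q_a) = 0`,
which forces `p = q`. Surjectivity comes from the algorithm. Write `y` as the projection of a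
probability vector `q`. Each step raises `∑ q_a log p_a` by the relative entropy of the projections
(`sum_mul_log_scalingIter_succ`), and after one step the mass is at most `1` by AM-GM
(`sum_scalingIter_succ_le`). The likelihood is then monotone and bounded, so the projections
converge to `y`. Any cluster point `r` projects to `y` and may replace `q`; the likelihood relative
to `r` then forces the whole sequence to `r`. The iterates stay in the closed torus orbit of `w`, so
`r` lies in `X_{A,w}`. Linear precision says that `β x` is normalized and projects to `x`, which
leaves only the inverse; a proper patch is the inverse composed with its tautological map. -/

noncomputable section

namespace ToricPatch

/-! ### Relative entropy dominates squared Hellinger distance. -/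

section Entropy

/-- This is `log x ≤ x - 1` at `x = √p / √q`, multiplied by `2q`. Square roots give a bound that
stays meaningful at `p = 0` or `q = 0`. -/
lemma sq_sqrt_sub_sqrt_le {q p : ℝ} (hq : 0 ≤ q) (hp : 0 ≤ p) (h : 0 < q → 0 < p) :
    (√q - √p) ^ 2 ≤ q * (Real.log q - Real.log p) - q + p := by
  rcases hq.eq_or_lt with rfl | hq'
  · simp [Real.sq_sqrt hp]
  have hp' := h hq'
  have hsq := Real.sqrt_pos.2 hq'
  have hsp := Real.sqrt_pos.2 hp'
  have h1 := Real.log_le_sub_one_of_pos (div_pos hsp hsq)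
  rw [Real.log_div hsp.ne' hsq.ne', Real.log_sqrt hp, Real.log_sqrt hq] at h1
  have h2 : q * (√p / √q) = √q * √p := by
    nth_rewrite 1 [← Real.mul_self_sqrt hq]
    field_simp
  have h3 := mul_le_mul_of_nonneg_left h1 hq
  have h4 := Real.sq_sqrt hq
  have h5 := Real.sq_sqrt hp
  nlinarith

lemma sum_sq_sqrt_sub_sqrt_le {ι : Type*} [Fintype ι] {q p : ι → ℝ} (hq : ∀ a, 0 ≤ q a)
    (hp : ∀ a, 0 ≤ p a) (h : ∀ a, 0 < q a → 0 < p a) :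
    ∑ a, (√(q a) - √(p a)) ^ 2 ≤
      ∑ a, q a * (Real.log (q a) - Real.log (p a)) - ∑ a, q a + ∑ a, p a := by
  rw [← Finset.sum_sub_distrib, ← Finset.sum_add_distrib]
  exact Finset.sum_le_sum fun a _ => sq_sqrt_sub_sqrt_le (hq a) (hp a) (h a)

lemma tendsto_of_sum_sq_sqrt_sub_sqrt {ι : Type*} [Fintype ι] {q : ι → ℝ} {p : ℕ → ι → ℝ}
    (hq : ∀ a, 0 ≤ q a) (hp : ∀ n a, 0 ≤ p n a)
    (h : Tendsto (fun n => ∑ a, (√(q a) - √(p n a)) ^ 2) atTop (𝓝 0)) :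
    Tendsto p atTop (𝓝 q) := by
  rw [tendsto_pi_nhds]
  intro a
  have h1 : Tendsto (fun n => (√(q a) - √(p n a)) ^ 2) atTop (𝓝 0) :=
    squeeze_zero (fun n => sq_nonneg _)
      (fun n => Finset.single_le_sum (f := fun a => (√(q a) - √(p n a)) ^ 2)
        (fun _ _ => sq_nonneg _) (Finset.mem_univ a)) h
  have h2 : Tendsto (fun n => √(q a) - √(p n a)) atTop (𝓝 0) := by
    have := h1.sqrt
    simp only [Real.sqrt_sq_eq_abs, Real.sqrt_zero] at this
    exact (tendsto_zero_iff_abs_tendsto_zero _).2 this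
  have h3 : Tendsto (fun n => √(p n a)) atTop (𝓝 √(q a)) := by
    simpa using (tendsto_const_nhds (x := √(q a))).sub h2
  simpa [Real.sq_sqrt, hq, hp] using h3.pow 2

end Entropy

/-! ### Representatives in the probability simplex. -/

section Normalize

variable {ι : Type*} [Fintype ι]

lemma sum_normalize {p : ι → ℝ} (h : ∑ a, p a ≠ 0) : ∑ a, normalize p a = 1 := by
  simp [normalize, ← Finset.mul_sum, h]

lemma normalize_of_sum_eq_one {p : ι → ℝ} (h : ∑ a, p a = 1) : normalize p = p := by
  simp [normalize, h]

lemma normalize_nonneg {p : ι → ℝ} (h : ∀ a, 0 ≤ p a) (a : ι) : 0 ≤ normalize p a :=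
  mul_nonneg (inv_nonneg.2 (Finset.sum_nonneg fun a _ => h a)) (h a)

lemma normalize_smul {c : ℝ} (hc : c ≠ 0) (p : ι → ℝ) : normalize (c • p) = normalize p := by
  simp only [normalize, Pi.smul_apply, smul_eq_mul, ← Finset.mul_sum, smul_smul]
  congr 1
  field_simp

lemma tendsto_normalize {α : Type*} {l : Filter α} {f : α → ι → ℝ} {p : ι → ℝ}
    (hp : ∑ a, p a ≠ 0) (h : Tendsto f l (𝓝 p)) :
    Tendsto (fun n => normalize (f n)) l (𝓝 (normalize p)) :=
  ((tendsto_finsetSum _ fun a _ => tendsto_pi_nhds.1 h a).inv₀ hp).smul h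

lemma linProj_normalize {κ : Type*} (v : ι → κ → ℝ) (p : ι → ℝ) :
    linProj v (normalize p) = tautProj v p := by
  simp [linProj, normalize, tautProj, Finset.smul_sum, mul_smul]

lemma tautProj_of_sum_eq_one {κ : Type*} (v : ι → κ → ℝ) {p : ι → ℝ} (h : ∑ a, p a = 1) :
    tautProj v p = linProj v p := by
  simp [tautProj, h]

end Normalize

/-! ### Convergence of generalized iterative scaling. -/

section Scaling

lemma linProj_apply {ι κ : Type*} [Fintype ι] (v : ι → κ → ℝ) (p : ι → ℝ) (i : κ) :
    linProj v p i = ∑ a, p a * v a i := by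
  simp [linProj, Finset.sum_apply]

lemma continuous_linProj {ι κ : Type*} [Fintype ι] (v : ι → κ → ℝ) :
    Continuous (linProj v) := by
  unfold linProj
  fun_prop

lemma linProj_nonneg {ι κ : Type*} [Fintype ι] {v : ι → κ → ℝ} (hv : ∀ a i, 0 ≤ v a i)
    {p : ι → ℝ} (hp : ∀ a, 0 ≤ p a) (i : κ) : 0 ≤ linProj v p i := by
  rw [linProj_apply]
  exact Finset.sum_nonneg fun a _ => mul_nonneg (hp a) (hv a i)

lemma linProj_pos {ι κ : Type*} [Fintype ι] {v : ι → κ → ℝ} (hv : ∀ a i, 0 ≤ v a i)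
    {p : ι → ℝ} (hp : ∀ a, 0 ≤ p a) {a : ι} {i : κ} (ha : 0 < p a) (hi : 0 < v a i) :
    0 < linProj v p i := by
  rw [linProj_apply]
  exact Finset.sum_pos' (fun a _ => mul_nonneg (hp a) (hv a i))
    ⟨a, Finset.mem_univ a, mul_pos ha hi⟩

variable {ι κ : Type*} [Fintype ι] [Fintype κ] {v : ι → κ → ℝ} {w p q : ι → ℝ} {y : κ → ℝ}

lemma sum_linProj (hs : ∀ a, ∑ i, v a i = 1) (p : ι → ℝ) :
    ∑ i, linProj v p i = ∑ a, p a := by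
  simp_rw [linProj_apply]
  rw [Finset.sum_comm]
  simp [← Finset.mul_sum, hs]

lemma monom_nonneg {κ : Type*} [Fintype κ] {y : κ → ℝ} (hy : ∀ i, 0 ≤ y i) (e : κ → ℝ) :
    0 ≤ monom y e :=
  Finset.prod_nonneg fun i _ => Real.rpow_nonneg (hy i) _

lemma monom_mul {κ : Type*} [Fintype κ] {x y : κ → ℝ} (hx : ∀ i, 0 ≤ x i) (hy : ∀ i, 0 ≤ y i)
    (e : κ → ℝ) : monom (x * y) e = monom x e * monom y e := by
  simp only [monom, Pi.mul_apply, ← Finset.prod_mul_distrib]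
  exact Finset.prod_congr rfl fun i _ => Real.mul_rpow (hx i) (hy i)

lemma monom_div {κ : Type*} [Fintype κ] {x y : κ → ℝ} (hx : ∀ i, 0 ≤ x i) (hy : ∀ i, 0 ≤ y i)
    (e : κ → ℝ) : monom (x / y) e = monom x e / monom y e := by
  simp only [monom, Pi.div_apply, ← Finset.prod_div_distrib]
  exact Finset.prod_congr rfl fun i _ => Real.div_rpow (hx i) (hy i) _

lemma monom_smul {κ : Type*} [Fintype κ] {c : ℝ} (hc : 0 < c) {y : κ → ℝ} (hy : ∀ i, 0 ≤ y i)
    {e : κ → ℝ} (he : ∑ i, e i = 1) : monom (c • y) e = c * monom y e := by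
  have : monom (fun _ => c) e = c := by
    rw [monom, ← Real.rpow_sum_of_pos hc, he, Real.rpow_one]
  conv_rhs => rw [← this]
  rw [← monom_mul (fun _ => hc.le) hy]
  rfl

lemma continuous_monom {κ : Type*} [Fintype κ] {e : κ → ℝ} (he : ∀ i, 0 ≤ e i) :
    Continuous fun y => monom y e :=
  continuous_finsetProd _ fun i _ =>
    (Real.continuous_rpow_const (he i)).comp (continuous_apply i)

lemma monom_le_sum {κ : Type*} [Fintype κ] {y e : κ → ℝ} (hy : ∀ i, 0 ≤ y i)
    (he : ∀ i, 0 ≤ e i) (hs : ∑ i, e i = 1) : monom y e ≤ ∑ i, e i * y i :=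
  Real.geom_mean_le_arith_mean_weighted _ _ _ (fun i _ => he i) hs fun i _ => hy i

lemma log_monom {κ : Type*} [Fintype κ] {y e : κ → ℝ} (h : ∀ i, e i ≠ 0 → 0 < y i) :
    Real.log (monom y e) = ∑ i, e i * Real.log (y i) := by
  rw [monom, Real.log_prod]
  · refine Finset.sum_congr rfl fun i _ => ?_
    by_cases hi : e i = 0
    · simp [hi]
    · exact Real.log_rpow (h i hi) _
  · intro i _
    by_cases hi : e i = 0
    · simp [hi]
    · exact (Real.rpow_pos_of_pos (h i hi) _).ne'

lemma monom_pos {κ : Type*} [Fintype κ] {y e : κ → ℝ} (h : ∀ i, e i ≠ 0 → 0 < y i) :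
    0 < monom y e := by
  refine Finset.prod_pos fun i _ => ?_
  by_cases hi : e i = 0
  · simp [hi]
  · exact Real.rpow_pos_of_pos (h i hi) _

lemma monom_linProj_pos (hv : ∀ a i, 0 ≤ v a i) (hp : ∀ a, 0 ≤ p a) {a : ι} (ha : 0 < p a) :
    0 < monom (linProj v p) (v a) :=
  monom_pos fun i hi => linProj_pos hv hp ha ((hv a i).lt_of_ne' hi)

lemma scalingIter_nonneg {ι κ : Type*} [Fintype κ] {v : ι → κ → ℝ} {w : ι → ℝ} {y : κ → ℝ}
    {proj : (ι → ℝ) → κ → ℝ}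
    (hproj : ∀ p, (∀ a, 0 ≤ p a) → ∀ i, 0 ≤ proj p i) (hw : ∀ a, 0 ≤ w a) (hy : ∀ i, 0 ≤ y i)
    (n : ℕ) (a : ι) : 0 ≤ scalingIter proj v w y n a := by
  induction n generalizing a with
  | zero => exact hw a
  | succ n ih =>
    exact mul_nonneg (ih a) (div_nonneg (monom_nonneg hy _) (monom_nonneg (hproj _ ih) _))

lemma scalingIter_linProj_nonneg (hv : ∀ a i, 0 ≤ v a i) (hw : ∀ a, 0 ≤ w a)
    (hy : ∀ i, 0 ≤ y i) (n : ℕ) (a : ι) : 0 ≤ scalingIter (linProj v) v w y n a :=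
  scalingIter_nonneg (fun _ hp => linProj_nonneg hv hp) hw hy n a

/-- The iterates stay in the orbit of `w` under the (closed) torus. -/
lemma exists_scalingIter_eq_mul_monom (hv : ∀ a i, 0 ≤ v a i) (hw : ∀ a, 0 ≤ w a)
    (hy : ∀ i, 0 ≤ y i) (n : ℕ) :
    ∃ θ : κ → ℝ, (∀ i, 0 ≤ θ i) ∧
      ∀ a, scalingIter (linProj v) v w y n a = w a * monom θ (v a) := by
  induction n with
  | zero => exact ⟨1, fun _ => zero_le_one, fun a => by simp [scalingIter, monom]⟩
  | succ n ih =>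
    obtain ⟨θ, hθ, h⟩ := ih
    have hP := linProj_nonneg hv (scalingIter_linProj_nonneg hv hw hy n)
    refine ⟨θ * (y / linProj v (scalingIter (linProj v) v w y n)),
      fun i => mul_nonneg (hθ i) (div_nonneg (hy i) (hP i)), fun a => ?_⟩
    rw [monom_mul hθ (y := y / _) fun i => div_nonneg (hy i) (hP i), monom_div hy hP, ← mul_assoc,
      ← h]
    rfl

/-- On the support of `q`, every coordinate of the target and of the current projection that enters
the update with nonzero exponent is positive, so no zero arises there. -/
lemma scalingIter_pos (hv : ∀ a i, 0 ≤ v a i) (hw : ∀ a, 0 < w a) (hq : ∀ a, 0 ≤ q a)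
    (n : ℕ) {a : ι} (ha : 0 < q a) : 0 < scalingIter (linProj v) v w (linProj v q) n a := by
  induction n with
  | zero => exact hw a
  | succ n ih =>
    exact mul_pos ih (div_pos (monom_linProj_pos hv hq ha) (monom_linProj_pos hv
      (scalingIter_linProj_nonneg hv (fun a => (hw a).le) (linProj_nonneg hv hq) n) ih))

/-- Weighted AM-GM bounds each monomial by a linear form, and the sum telescopes to `∑ y_i`.
Coordinates with zero projection contribute `0`, whence only an inequality at the end. -/
lemma sum_scalingIter_succ_le (hv : ∀ a i, 0 ≤ v a i) (hs : ∀ a, ∑ i, v a i = 1)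
    (hw : ∀ a, 0 ≤ w a) (hy : ∀ i, 0 ≤ y i) (n : ℕ) :
    ∑ a, scalingIter (linProj v) v w y (n + 1) a ≤ ∑ i, y i := by
  have hp := scalingIter_linProj_nonneg hv hw hy n
  have hP := linProj_nonneg hv hp
  set p := scalingIter (linProj v) v w y n with hpdef
  calc ∑ a, scalingIter (linProj v) v w y (n + 1) a
      = ∑ a, p a * monom (y / linProj v p) (v a) := by
        refine Finset.sum_congr rfl fun a _ => ?_
        rw [monom_div hy hP]
        rfl
    _ ≤ ∑ a, p a * ∑ i, v a i * (y i / linProj v p i) :=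
        Finset.sum_le_sum fun a _ => mul_le_mul_of_nonneg_left
          (monom_le_sum (fun i => div_nonneg (hy i) (hP i)) (hv a) (hs a)) (hp a)
    _ = ∑ i, linProj v p i * (y i / linProj v p i) := by
        simp_rw [Finset.mul_sum]
        rw [Finset.sum_comm]
        refine Finset.sum_congr rfl fun i _ => ?_
        rw [linProj_apply, Finset.sum_mul]
        exact Finset.sum_congr rfl fun a _ => by ring
    _ ≤ ∑ i, y i := by
        refine Finset.sum_le_sum fun i _ => ?_
        by_cases h : linProj v p i = 0
        · simp [h, hy i]
        · rw [mul_div_cancel₀ _ h]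

/-- The gain in log-likelihood in one step is the relative entropy of the projections. -/
lemma sum_mul_log_scalingIter_succ (hv : ∀ a i, 0 ≤ v a i) (hw : ∀ a, 0 < w a)
    (hq : ∀ a, 0 ≤ q a) (n : ℕ) :
    ∑ a, q a * Real.log (scalingIter (linProj v) v w (linProj v q) (n + 1) a) =
      ∑ a, q a * Real.log (scalingIter (linProj v) v w (linProj v q) n a) +
      ∑ i, linProj v q i * (Real.log (linProj v q i) -
        Real.log (linProj v (scalingIter (linProj v) v w (linProj v q) n) i)) := by
  have hp := scalingIter_linProj_nonneg hv (fun a => (hw a).le) (linProj_nonneg hv hq) n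
  have hpos := fun a => scalingIter_pos (a := a) hv hw hq n
  set y := linProj v q with hy
  set p := scalingIter (linProj v) v w y n with hpdef
  have h1 : ∀ a, q a * Real.log (scalingIter (linProj v) v w y (n + 1) a) =
      q a * Real.log (p a) +
        ∑ i, q a * v a i * (Real.log (y i) - Real.log (linProj v p i)) := by
    intro a
    rcases (hq a).eq_or_lt with h0 | ha
    · simp [← h0]
    have hpa := hpos a ha
    have e : scalingIter (linProj v) v w y (n + 1) a =
        p a * (monom y (v a) / monom (linProj v p) (v a)) := rfl
    have my := monom_linProj_pos hv hq ha
    have mp := monom_linProj_pos hv hp hpa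
    rw [e, Real.log_mul hpa.ne' (div_pos my mp).ne', Real.log_div my.ne' mp.ne',
      log_monom fun i hi => linProj_pos hv hq ha ((hv a i).lt_of_ne' hi),
      log_monom fun i hi => linProj_pos hv hp hpa ((hv a i).lt_of_ne' hi),
      ← Finset.sum_sub_distrib, mul_add, Finset.mul_sum]
    congr 1
    exact Finset.sum_congr rfl fun i _ => by ring
  rw [Finset.sum_congr rfl fun a _ => h1 a, Finset.sum_add_distrib]
  congr 1
  rw [Finset.sum_comm]
  refine Finset.sum_congr rfl fun i _ => ?_
  rw [← Finset.sum_mul, hy, linProj_apply v q]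

lemma pos_linProj_scalingIter (hv : ∀ a i, 0 ≤ v a i) (hw : ∀ a, 0 < w a)
    (hq : ∀ a, 0 ≤ q a) (n : ℕ) (i : κ) (hi : 0 < linProj v q i) :
    0 < linProj v (scalingIter (linProj v) v w (linProj v q) n) i := by
  rw [linProj_apply] at hi
  obtain ⟨a, -, ha⟩ := Finset.exists_lt_of_sum_lt (s := Finset.univ) (f := fun _ => (0 : ℝ))
    (by simpa using hi)
  have hqa : 0 < q a := (hq a).lt_of_ne' fun h => by simp [h] at ha
  have hva : 0 < v a i := (hv a i).lt_of_ne' fun h => by simp [h] at ha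
  exact linProj_pos hv
    (scalingIter_linProj_nonneg hv (fun a => (hw a).le) (linProj_nonneg hv hq) n)
    (scalingIter_pos hv hw hq n hqa) hva

/-- The index starts at `n + 1` because `w` has arbitrary mass; only after one step is the mass at
most that of `q`, which gives the entropy bound the right sign. -/
lemma sum_sq_sqrt_le_gain (hv : ∀ a i, 0 ≤ v a i) (hs : ∀ a, ∑ i, v a i = 1)
    (hw : ∀ a, 0 < w a) (hq : ∀ a, 0 ≤ q a) (n : ℕ) :
    ∑ i, (√(linProj v q i) -
        √(linProj v (scalingIter (linProj v) v w (linProj v q) (n + 1)) i)) ^ 2 ≤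
      ∑ a, q a * Real.log (scalingIter (linProj v) v w (linProj v q) (n + 2) a) -
      ∑ a, q a * Real.log (scalingIter (linProj v) v w (linProj v q) (n + 1) a) := by
  have hp := scalingIter_linProj_nonneg hv (fun a => (hw a).le) (linProj_nonneg hv hq) (n + 1)
  have h := sum_sq_sqrt_sub_sqrt_le (linProj_nonneg hv hq) (linProj_nonneg hv hp)
    (pos_linProj_scalingIter hv hw hq (n + 1))
  rw [sum_linProj hs (scalingIter _ _ _ _ _)] at h
  have h1 := sum_scalingIter_succ_le hv hs (fun a => (hw a).le) (linProj_nonneg hv hq) n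
  have h2 := sum_mul_log_scalingIter_succ hv hw hq (n + 1)
  linarith

lemma monotone_sum_mul_log_scalingIter (hv : ∀ a i, 0 ≤ v a i) (hs : ∀ a, ∑ i, v a i = 1)
    (hw : ∀ a, 0 < w a) (hq : ∀ a, 0 ≤ q a) :
    Monotone fun n =>
      ∑ a, q a * Real.log (scalingIter (linProj v) v w (linProj v q) (n + 1) a) :=
  monotone_nat_of_le_succ fun n => sub_nonneg.1 <|
    (Finset.sum_nonneg fun _ _ => sq_nonneg _).trans (sum_sq_sqrt_le_gain hv hs hw hq n)

lemma scalingIter_succ_mem_Icc (hv : ∀ a i, 0 ≤ v a i) (hs : ∀ a, ∑ i, v a i = 1)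
    (hw : ∀ a, 0 ≤ w a) (hy : ∀ i, 0 ≤ y i) (hy1 : ∑ i, y i = 1) (n : ℕ) :
    scalingIter (linProj v) v w y (n + 1) ∈ Icc (0 : ι → ℝ) 1 := by
  have h0 := scalingIter_linProj_nonneg hv hw hy (n + 1)
  refine ⟨h0, fun a => ?_⟩
  exact ((Finset.single_le_sum (fun a _ => h0 a) (Finset.mem_univ a)).trans
    (sum_scalingIter_succ_le hv hs hw hy n)).trans hy1.le

lemma tendsto_linProj_scalingIter (hv : ∀ a i, 0 ≤ v a i) (hs : ∀ a, ∑ i, v a i = 1)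
    (hw : ∀ a, 0 < w a) (hq : ∀ a, 0 ≤ q a) (hq1 : ∑ a, q a = 1) :
    Tendsto (fun n => linProj v (scalingIter (linProj v) v w (linProj v q) (n + 1))) atTop
      (𝓝 (linProj v q)) := by
  have hy := linProj_nonneg hv hq
  have hw' := fun a => (hw a).le
  refine tendsto_of_sum_sq_sqrt_sub_sqrt hy
    (fun n => linProj_nonneg hv (scalingIter_linProj_nonneg hv hw' hy (n + 1))) ?_
  have hbdd : BddAbove (range fun n =>
      ∑ a, q a * Real.log (scalingIter (linProj v) v w (linProj v q) (n + 1) a)) := by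
    refine ⟨0, ?_⟩
    rintro _ ⟨n, rfl⟩
    refine Finset.sum_nonpos fun a _ => mul_nonpos_of_nonneg_of_nonpos (hq a) ?_
    have := scalingIter_succ_mem_Icc hv hs hw' hy ((sum_linProj hs q).trans hq1) n
    exact Real.log_nonpos (this.1 a) (this.2 a)
  have hL := tendsto_atTop_ciSup (monotone_sum_mul_log_scalingIter hv hs hw hq) hbdd
  have hd := ((tendsto_add_atTop_iff_nat 1).2 hL).sub hL
  rw [sub_self] at hd
  exact squeeze_zero (fun n => Finset.sum_nonneg fun _ _ => sq_nonneg _)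
    (sum_sq_sqrt_le_gain hv hs hw hq) hd

/-- **Darroch–Ratcliff**: generalized iterative scaling converges to a point of the fibre. -/
theorem exists_tendsto_scalingIter (hv : ∀ a i, 0 ≤ v a i) (hs : ∀ a, ∑ i, v a i = 1)
    (hw : ∀ a, 0 < w a) (hq : ∀ a, 0 ≤ q a) (hq1 : ∑ a, q a = 1) :
    ∃ r : ι → ℝ, (∀ a, 0 ≤ r a) ∧ linProj v r = linProj v q ∧
      Tendsto (scalingIter (linProj v) v w (linProj v q)) atTop (𝓝 r) := by
  have hy := linProj_nonneg hv hq
  have hw' := fun a => (hw a).le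
  have hy1 := (sum_linProj hs q).trans hq1
  obtain ⟨r, hr, φ, hφ, hlim⟩ := (isCompact_Icc (a := (0 : ι → ℝ)) (b := 1)).tendsto_subseq
    (scalingIter_succ_mem_Icc hv hs hw' hy hy1)
  have hr0 : ∀ a, 0 ≤ r a := hr.1
  have hproj : linProj v r = linProj v q := tendsto_nhds_unique
    ((continuous_linProj v).continuousAt.tendsto.comp hlim)
    ((tendsto_linProj_scalingIter hv hs hw hq hq1).comp hφ.tendsto_atTop)
  refine ⟨r, hr0, hproj, ?_⟩
  rw [← tendsto_add_atTop_iff_nat 1]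
  have hr1 : ∑ a, r a = 1 := by rw [← sum_linProj hs, hproj, hy1]
  -- The iteration sees `q` only through its projection, so `r` can serve as the reference vector.
  rw [← hproj] at hlim hy hy1 ⊢
  have hsub : Tendsto (fun n =>
      ∑ a, r a * Real.log (scalingIter (linProj v) v w (linProj v r) (φ n + 1) a)) atTop
      (𝓝 (∑ a, r a * Real.log (r a))) := by
    refine tendsto_finsetSum _ fun a _ => ?_
    rcases (hr0 a).eq_or_lt with h0 | ha
    · simp [← h0]
    · exact ((Real.continuousAt_log ha.ne').tendsto.comp
        (tendsto_pi_nhds.1 hlim a)).const_mul _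
  -- Monotonicity upgrades the limit along `φ` to a limit of the full sequence.
  have hL := (tendsto_iff_tendsto_subseq_of_monotone
    (monotone_sum_mul_log_scalingIter hv hs hw hr0) hφ.tendsto_atTop).2 hsub
  have hd := (tendsto_const_nhds (x := ∑ a, r a * Real.log (r a))).sub hL
  rw [sub_self] at hd
  refine tendsto_of_sum_sq_sqrt_sub_sqrt hr0
    (fun n => scalingIter_linProj_nonneg hv hw' hy (n + 1))
    (squeeze_zero (fun n => Finset.sum_nonneg fun _ _ => sq_nonneg _) (fun n => ?_) hd)
  have h1 := sum_sq_sqrt_sub_sqrt_le hr0 (scalingIter_linProj_nonneg hv hw' hy (n + 1))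
    (fun a => scalingIter_pos hv hw hr0 (n + 1))
  have h2 := sum_scalingIter_succ_le hv hs hw' hy n
  simp only [mul_sub, Finset.sum_sub_distrib] at h1
  linarith

/-- Iterative proportional fitting and generalized iterative scaling define the same sequence of
projective points. -/
lemma normalize_scalingIter_tautProj (hv : ∀ a i, 0 ≤ v a i) (hs : ∀ a, ∑ i, v a i = 1)
    (hw : ∀ a, 0 < w a) (hq : ∀ a, 0 ≤ q a) (hq1 : ∑ a, q a = 1) (n : ℕ) :
    normalize (scalingIter (tautProj v) v w (linProj v q) n) =
      normalize (scalingIter (linProj v) v w (linProj v q) n) := by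
  obtain ⟨a₀, -, ha₀⟩ := Finset.exists_lt_of_sum_lt (s := Finset.univ) (f := fun _ => (0 : ℝ))
    (g := q) (by simp [hq1])
  have hsum : ∀ n, 0 < ∑ a, scalingIter (linProj v) v w (linProj v q) n a := fun n =>
    Finset.sum_pos' (fun a _ => scalingIter_linProj_nonneg hv (fun a => (hw a).le)
      (linProj_nonneg hv hq) n a) ⟨a₀, Finset.mem_univ _, scalingIter_pos hv hw hq n ha₀⟩
  -- The exponents sum to `1`, so dividing the projection by the mass multiplies every coordinate of
  -- the update by that mass.
  have key : ∃ c : ℝ, 0 < c ∧ scalingIter (tautProj v) v w (linProj v q) n =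
      c • scalingIter (linProj v) v w (linProj v q) n := by
    induction n with
    | zero => exact ⟨1, one_pos, by simp [scalingIter]⟩
    | succ n ih =>
      obtain ⟨c, hc, h⟩ := ih
      have hp := scalingIter_linProj_nonneg hv (fun a => (hw a).le) (linProj_nonneg hv hq) n
      have hS := hsum n
      set p := scalingIter (linProj v) v w (linProj v q) n with hpdef
      have ht : tautProj v (c • p) = (∑ a, p a)⁻¹ • linProj v p := by
        have : linProj v (c • p) = c • linProj v p := by
          simp [linProj, Finset.smul_sum, mul_smul]
        simp only [tautProj, this, Pi.smul_apply, smul_eq_mul, ← Finset.mul_sum, smul_smul]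
        congr 1
        field_simp
      refine ⟨c * ∑ a, p a, mul_pos hc hS, funext fun a => ?_⟩
      have e1 : scalingIter (tautProj v) v w (linProj v q) (n + 1) a =
          (c • p) a * (monom (linProj v q) (v a) / monom (tautProj v (c • p)) (v a)) := by
        rw [← h]; rfl
      have e2 : scalingIter (linProj v) v w (linProj v q) (n + 1) a =
          p a * (monom (linProj v q) (v a) / monom (linProj v p) (v a)) := rfl
      rw [Pi.smul_apply, e1, e2, ht, monom_smul (inv_pos.2 hS) (linProj_nonneg hv hp) (hs a)]
      simp only [Pi.smul_apply, smul_eq_mul, div_eq_mul_inv, mul_inv, inv_inv]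
      ring
  obtain ⟨c, hc, h⟩ := key
  rw [h, normalize_smul hc.ne']

end Scaling

/-! ### The polytope and admissible normalizations. -/

variable {d : ℕ} {A : Finset (Fin d → ℤ)} {w : A → ℝ}

lemma mem_polytope_iff {y : Fin d → ℝ} :
    y ∈ polytope A ↔ ∃ q : A → ℝ, (∀ a, 0 ≤ q a) ∧ ∑ a, q a = 1 ∧ linProj (pts A) q = y := by
  constructor
  · intro hy
    refine convexHull_min (t := {y | ∃ q : A → ℝ, (∀ a, 0 ≤ q a) ∧ ∑ a, q a = 1 ∧
      linProj (pts A) q = y}) ?_ ?_ hy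
    · classical
      rintro _ ⟨a, rfl⟩
      refine ⟨Pi.single a 1, fun c => ?_, by simp, by simp [linProj, Pi.single_apply]⟩
      by_cases h : c = a
      · subst h; simp
      · simp [h]
    · rintro _ ⟨p, hp, hp1, rfl⟩ _ ⟨q, hq, hq1, rfl⟩ r s hr hs hrs
      refine ⟨r • p + s • q, fun a => ?_, ?_, ?_⟩
      · exact add_nonneg (mul_nonneg hr (hp a)) (mul_nonneg hs (hq a))
      · simp only [Pi.add_apply, Pi.smul_apply, smul_eq_mul, Finset.sum_add_distrib,
          ← Finset.mul_sum, hp1, hq1, mul_one, hrs]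
      · simp [linProj, Finset.smul_sum, add_smul, mul_smul, Finset.sum_add_distrib]
  · rintro ⟨q, hq, hq1, rfl⟩
    exact (convex_convexHull ℝ _).sum_mem (fun a _ => hq a) hq1
      fun a _ => subset_convexHull ℝ _ (mem_range_self a)

lemma nonempty_of_affineSpan_polytope (hA : affineSpan ℝ (polytope A) = ⊤) : Nonempty A := by
  by_contra h
  rw [not_nonempty_iff] at h
  have : polytope A = ∅ := by
    rw [polytope, range_eq_empty, convexHull_empty]
  rw [this, AffineSubspace.span_empty] at hA
  exact AffineSubspace.bot_ne_top ℝ (Fin d → ℝ) (Fin d → ℝ) hA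

lemma exists_isNormalizing (A : Finset (Fin d → ℤ)) : ∃ b t, IsNormalizing A b t := by
  obtain ⟨M, hM⟩ : ∃ M : ℝ, ∀ a : A, ∀ i, |pts A a i| ≤ M := by
    obtain ⟨M, hM⟩ := (Set.finite_range fun x : A × Fin d => |pts A x.1 x.2|).bddAbove
    exact ⟨M, fun a i => hM ⟨(a, i), rfl⟩⟩
  have hpos : 0 < 2 * |M| * d + 1 := by positivity
  -- After the shift, coordinates lie in `[0, 2|M|]`; the `+ 1` keeps the divisor positive when `M`
  -- or `d` is `0`.
  refine ⟨fun _ => |M|, (2 * |M| * d + 1)⁻¹, inv_pos.2 hpos, fun a => ⟨fun i => ?_, ?_⟩⟩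
  · have := (abs_le.1 ((hM a i).trans (le_abs_self M))).1
    exact mul_nonneg (inv_pos.2 hpos).le (by simp only [Pi.add_apply]; linarith)
  · simp only [Pi.smul_apply, Pi.add_apply, smul_eq_mul, ← Finset.mul_sum]
    rw [inv_mul_le_iff₀ hpos, mul_one]
    have h : ∑ i : Fin d, (pts A a i + |M|) ≤ ∑ _i : Fin d, 2 * |M| :=
      Finset.sum_le_sum fun i _ => by
        have := (abs_le.1 ((hM a i).trans (le_abs_self M))).2
        linarith
    simp at h
    linarith

/-! ### Homogeneous coordinates and torus orbits. -/

section Homog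

variable {b : Fin d → ℝ} {t : ℝ}

lemma sum_homog (b : Fin d → ℝ) (t : ℝ) (y : Fin d → ℝ) : ∑ i, homog b t y i = 1 := by
  rw [Fin.sum_univ_succ]
  exact sub_add_cancel 1 _

lemma homog_pts_nonneg (h : IsNormalizing A b t) (a : A) (i : Fin (d + 1)) :
    0 ≤ homog b t (pts A a) i := by
  refine Fin.cases ?_ (fun i => ?_) i
  · exact sub_nonneg.2 (h.2 a).2
  · exact (h.2 a).1 i

lemma linProj_homog {ι : Type*} [Fintype ι] (u : ι → Fin d → ℝ) {q : ι → ℝ}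
    (hq : ∑ a, q a = 1) :
    linProj (fun a => homog b t (u a)) q = homog b t (linProj u q) := by
  have h1 : ∀ i : Fin d, linProj (fun a => homog b t (u a)) q i.succ =
      homog b t (linProj u q) i.succ := by
    intro i
    simp only [linProj_apply, homog, Fin.cons_succ, Pi.smul_apply, Pi.add_apply, smul_eq_mul]
    have : ∀ a, q a * (t * (u a i + b i)) = t * (q a * u a i) + t * b i * q a :=
      fun a => by ring
    rw [Finset.sum_congr rfl fun a _ => this a, Finset.sum_add_distrib, ← Finset.mul_sum,
      ← Finset.mul_sum, hq]
    ring
  have h2 := (sum_linProj (fun a => sum_homog b t (u a)) q).trans hq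
  have h3 := sum_homog b t (linProj u q)
  rw [Fin.sum_univ_succ] at h2 h3
  rw [Finset.sum_congr rfl fun i _ => h1 i] at h2
  ext i
  refine Fin.cases ?_ (fun i => h1 i) i
  linarith

lemma linProj_eq_of_linProj_homog_eq {ι : Type*} [Fintype ι] {u : ι → Fin d → ℝ} (ht : 0 < t)
    {p q : ι → ℝ} (hp : ∑ a, p a = 1) (hq : ∑ a, q a = 1)
    (h : linProj (fun a => homog b t (u a)) p = linProj (fun a => homog b t (u a)) q) :
    linProj u p = linProj u q := by
  rw [linProj_homog u hp, linProj_homog u hq] at h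
  ext i
  have := congrFun h i.succ
  simpa [homog, ht.ne'] using this

/-- Monomials in homogeneous coordinates are, up to a common factor, monomials. -/
lemma exists_monom_homog_eq (b : Fin d → ℝ) (t : ℝ) {θ : Fin (d + 1) → ℝ}
    (hθ : ∀ i, 0 < θ i) :
    ∃ c : ℝ, 0 < c ∧ ∃ x : Fin d → ℝ, (∀ i, 0 < x i) ∧
      ∀ a : A, monom θ (homog b t (pts A a)) = c * ∏ i, x i ^ (a.1 i) := by
  -- `homog b t` is affine with value `homog b t 0` at the origin; its slope in direction `i` is `t`
  -- in coordinate `i + 1` and `-t` in coordinate `0`.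
  refine ⟨monom θ (homog b t 0), monom_pos fun i _ => hθ i,
    fun i => (θ i.succ / θ 0) ^ t, fun i => Real.rpow_pos_of_pos (div_pos (hθ _) (hθ _)) _,
    fun a => ?_⟩
  have hx : 0 < ∏ i : Fin d, ((θ i.succ / θ 0) ^ t) ^ (a.1 i) :=
    Finset.prod_pos fun i _ => zpow_pos (Real.rpow_pos_of_pos (div_pos (hθ _) (hθ _)) _) _
  have hm : ∀ e, 0 < monom θ e := fun e => monom_pos fun i _ => hθ i
  refine Real.log_injOn_pos (hm _) (mul_pos (hm _) hx) ?_
  rw [Real.log_mul (hm _).ne' hx.ne', log_monom fun i _ => hθ i, log_monom fun i _ => hθ i,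
    Real.log_prod fun i _ =>
      (zpow_pos (Real.rpow_pos_of_pos (div_pos (hθ _) (hθ _)) _) _).ne']
  have : ∀ i : Fin d, Real.log (((θ i.succ / θ 0) ^ t) ^ (a.1 i)) =
      pts A a i * (t * (Real.log (θ i.succ) - Real.log (θ 0))) := fun i => by
    rw [Real.log_zpow, Real.log_rpow (div_pos (hθ _) (hθ _)),
      Real.log_div (hθ _).ne' (hθ _).ne', pts]
  simp only [this, Fin.sum_univ_succ, homog, Fin.cons_zero, Fin.cons_succ, Pi.smul_apply,
    Pi.add_apply, smul_eq_mul, zero_add, mul_add, mul_sub, add_mul, sub_mul, Finset.sum_mul,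
    one_mul, Finset.sum_add_distrib, Finset.sum_sub_distrib]
  have h1 : ∀ i : Fin d, t * pts A a i * Real.log (θ i.succ) =
      pts A a i * (t * Real.log (θ i.succ)) := fun i => by ring
  have h2 : ∀ i : Fin d, t * pts A a i * Real.log (θ 0) =
      pts A a i * (t * Real.log (θ 0)) := fun i => by ring
  simp only [h1, h2]
  ring

lemma normalize_mul_monom_mem_toricVariety_of_pos (b : Fin d → ℝ) (t : ℝ)
    {θ : Fin (d + 1) → ℝ} (hθ : ∀ i, 0 < θ i) :
    normalize (fun a => w a * monom θ (homog b t (pts A a))) ∈ toricVariety A w := by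
  obtain ⟨c, hc, x, hx, h⟩ := exists_monom_homog_eq (A := A) b t hθ
  refine subset_closure ⟨x, hx, ?_⟩
  have : (fun a => w a * monom θ (homog b t (pts A a))) = c • monomMap A w x := by
    ext a
    simp only [h, monomMap, Pi.smul_apply, smul_eq_mul]
    ring
  rw [this, normalize_smul hc.ne']

/-- Boundary parameters are limits of `θ + ε`; non-negative exponents make the monomials continuous
there. -/
lemma normalize_mul_monom_mem_toricVariety (hbt : IsNormalizing A b t)
    {θ : Fin (d + 1) → ℝ} (hθ : ∀ i, 0 ≤ θ i)
    (hs : ∑ a, w a * monom θ (homog b t (pts A a)) ≠ 0) :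
    normalize (fun a => w a * monom θ (homog b t (pts A a))) ∈ toricVariety A w := by
  have hlim : Tendsto (fun ε : ℝ => θ + fun _ => ε) (𝓝[>] 0) (𝓝 θ) := by
    have : Continuous fun ε : ℝ => θ + fun _ => ε := by fun_prop
    have h := this.tendsto 0
    simp only [show (θ + fun _ => (0 : ℝ)) = θ from add_zero θ] at h
    exact h.mono_left nhdsWithin_le_nhds
  have h2 : Tendsto (fun ε : ℝ => fun a : A =>
      w a * monom (θ + fun _ => ε) (homog b t (pts A a))) (𝓝[>] 0)
      (𝓝 fun a => w a * monom θ (homog b t (pts A a))) := by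
    rw [tendsto_pi_nhds]
    intro a
    exact (((continuous_monom (homog_pts_nonneg hbt a)).tendsto θ).comp hlim).const_mul _
  refine isClosed_closure.mem_of_tendsto (tendsto_normalize hs h2) ?_
  filter_upwards [self_mem_nhdsWithin] with ε hε
  exact normalize_mul_monom_mem_toricVariety_of_pos b t fun i =>
    add_pos_of_nonneg_of_pos (hθ i) hε

end Homog

/-! ### Birch's theorem on the toric variety. -/

section Variety

lemma monomMap_pos (hw : ∀ a, 0 < w a) {x : Fin d → ℝ} (hx : ∀ i, 0 < x i) (a : A) :
    0 < monomMap A w x a :=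
  mul_pos (hw a) (Finset.prod_pos fun i _ => zpow_pos (hx i) _)

lemma toricVariety_subset_stdSimplex [Nonempty A] (hw : ∀ a, 0 < w a) :
    toricVariety A w ⊆ stdSimplex ℝ A := by
  refine closure_minimal ?_ (isClosed_stdSimplex ℝ A)
  rintro _ ⟨x, hx, rfl⟩
  have h := monomMap_pos hw hx
  exact ⟨normalize_nonneg fun a => (h a).le,
    sum_normalize (Finset.sum_pos (fun a _ => h a) Finset.univ_nonempty).ne'⟩

/-- The binomial equations of the toric variety, with real exponents. -/
lemma monom_eq_monom_of_mem_toricVariety [Nonempty A] (hw : ∀ a, 0 < w a) {p : A → ℝ}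
    (hp : p ∈ toricVariety A w) {e f : A → ℝ} (he : ∀ a, 0 ≤ e a) (hf : ∀ a, 0 ≤ f a)
    (hs : ∑ a, e a = ∑ a, f a) (hl : linProj (pts A) e = linProj (pts A) f) :
    monom (p / w) e = monom (p / w) f := by
  have hc : ∀ {e : A → ℝ}, (∀ a, 0 ≤ e a) → Continuous fun p : A → ℝ => monom (p / w) e :=
    fun he => (continuous_monom he).comp
      (continuous_pi fun a => (continuous_apply (A := fun _ : A => ℝ) a).div_const (w a))
  refine closure_minimal (t := {p | monom (p / w) e = monom (p / w) f}) ?_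
    (isClosed_eq (hc he) (hc hf)) hp
  rintro _ ⟨x, hx, rfl⟩
  have hm := monomMap_pos hw hx
  have hS := Finset.sum_pos (fun a _ => hm a) Finset.univ_nonempty
  set S := ∑ a, monomMap A w x a with hSdef
  have hval : ∀ a, (normalize (monomMap A w x) / w) a = S⁻¹ * ∏ i, x i ^ (a.1 i) := fun a => by
    rw [Pi.div_apply, normalize, Pi.smul_apply, smul_eq_mul, ← hSdef, monomMap, mul_div_assoc,
      mul_div_cancel_left₀ _ (hw a).ne']
  have hpos : ∀ a, 0 < (normalize (monomMap A w x) / w) a := fun a => by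
    rw [hval]
    exact mul_pos (inv_pos.2 hS) (Finset.prod_pos fun i _ => zpow_pos (hx i) _)
  have hlog : ∀ a, Real.log ((normalize (monomMap A w x) / w) a) =
      Real.log S⁻¹ + ∑ i, pts A a i * Real.log (x i) := fun a => by
    rw [hval, Real.log_mul (inv_pos.2 hS).ne'
      (Finset.prod_pos fun i _ => zpow_pos (hx i) _).ne',
      Real.log_prod fun i _ => (zpow_pos (hx i) _).ne']
    simp only [Real.log_zpow, pts]
  have hsum : ∀ e : A → ℝ, Real.log (monom (normalize (monomMap A w x) / w) e) =
      (∑ a, e a) * Real.log S⁻¹ + ∑ i, linProj (pts A) e i * Real.log (x i) := fun e => by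
    rw [log_monom fun a _ => hpos a]
    simp only [hlog, mul_add, Finset.sum_add_distrib, Finset.sum_mul, linProj_apply,
      Finset.mul_sum]
    congr 1
    rw [Finset.sum_comm]
    simp only [mul_assoc]
  refine Real.log_injOn_pos (monom_pos fun a _ => hpos a) (monom_pos fun a _ => hpos a) ?_
  rw [hsum, hsum, hs, hl]

/-- The positive and negative parts of `p - q` are the two exponents of a binomial equation; its
logarithm is the claimed sum. -/
lemma sum_sub_mul_log_of_mem_toricVariety [Nonempty A] (hw : ∀ a, 0 < w a) {p q : A → ℝ}
    (hp : p ∈ toricVariety A w) (hq : q ∈ toricVariety A w)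
    (hl : linProj (pts A) p = linProj (pts A) q) :
    (∀ a, p a ≠ q a → 0 < p a) ∧
      ∑ a, (p a - q a) * (Real.log (p a) - Real.log (w a)) = 0 := by
  have hps := toricVariety_subset_stdSimplex hw hp
  have hqs := toricVariety_subset_stdSimplex hw hq
  have hsub : ∀ a, p a - q a = max (p a - q a) 0 - max (q a - p a) 0 := fun a => by
    rcases le_total (p a) (q a) with h | h
    · rw [max_eq_right (sub_nonpos.2 h), max_eq_left (sub_nonneg.2 h)]; ring
    · rw [max_eq_left (sub_nonneg.2 h), max_eq_right (sub_nonpos.2 h)]; ring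
  have heq := monom_eq_monom_of_mem_toricVariety hw hp
    (e := fun a => max (p a - q a) 0) (f := fun a => max (q a - p a) 0)
    (fun a => le_max_right _ _) (fun a => le_max_right _ _)
    (by
      rw [← sub_eq_zero, ← Finset.sum_sub_distrib, ← Finset.sum_congr rfl fun a _ => hsub a,
        Finset.sum_sub_distrib, hps.2, hqs.2, sub_self])
    (by
      rw [← sub_eq_zero] at hl ⊢
      rw [← hl]
      simp only [linProj, ← Finset.sum_sub_distrib, ← sub_smul, ← hsub])
  have he : ∀ a, max (p a - q a) 0 ≠ 0 → 0 < (p / w) a := fun a ha => by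
    have : q a < p a := by
      by_contra h
      exact ha (max_eq_right (sub_nonpos.2 (not_lt.1 h)))
    exact div_pos ((hqs.1 a).trans_lt this) (hw a)
  -- Where `p < q`, positivity of `p` is not evident: it is carried over from the other monomial by
  -- the binomial equation.
  have hf : ∀ a, max (q a - p a) 0 ≠ 0 → 0 < (p / w) a := fun a ha => by
    have h0 := (monom_pos he).ne'
    rw [heq, monom, Finset.prod_ne_zero_iff] at h0
    refine (div_nonneg (hps.1 a) (hw a).le).lt_of_ne' fun h => h0 a (Finset.mem_univ a) ?_
    rw [Pi.div_apply, h, Real.zero_rpow ha]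
  have hpos : ∀ a, p a ≠ q a → 0 < p a := fun a ha => by
    have : 0 < (p / w) a := by
      rcases ha.lt_or_gt with h | h
      · exact hf a (lt_max_of_lt_left (sub_pos.2 h)).ne'
      · exact he a (lt_max_of_lt_left (sub_pos.2 h)).ne'
    exact (div_pos_iff_of_pos_right (hw a)).1 this
  refine ⟨hpos, ?_⟩
  have hlog := congrArg Real.log heq
  rw [log_monom he, log_monom hf, ← sub_eq_zero, ← Finset.sum_sub_distrib] at hlog
  rw [← hlog]
  refine Finset.sum_congr rfl fun a _ => ?_
  rw [← sub_mul, ← hsub]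
  by_cases h : p a = q a
  · simp [h]
  · rw [Pi.div_apply, Real.log_div (hpos a h).ne' (hw a).ne']

/-- **Birch's theorem**, uniqueness part: the tautological projection is injective on the
toric variety. -/
theorem eq_of_mem_toricVariety_of_linProj_eq [Nonempty A] (hw : ∀ a, 0 < w a) {p q : A → ℝ}
    (hp : p ∈ toricVariety A w) (hq : q ∈ toricVariety A w)
    (hl : linProj (pts A) p = linProj (pts A) q) : p = q := by
  obtain ⟨hp0, hps⟩ := sum_sub_mul_log_of_mem_toricVariety hw hp hq hl
  obtain ⟨hq0, hqs⟩ := sum_sub_mul_log_of_mem_toricVariety hw hq hp hl.symm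
  have hsum : ∑ a, (p a - q a) * (Real.log (p a) - Real.log (q a)) = 0 := by
    rw [← add_zero (0 : ℝ)]
    nth_rewrite 1 [← hps]
    rw [← hqs, ← Finset.sum_add_distrib]
    exact Finset.sum_congr rfl fun a _ => by ring
  have hterm : ∀ a, p a ≠ q a → 0 < (p a - q a) * (Real.log (p a) - Real.log (q a)) := by
    intro a ha
    rcases ha.lt_or_gt with h | h
    · exact mul_pos_of_neg_of_neg (sub_neg.2 h)
        (sub_neg.2 (Real.log_lt_log (hp0 a ha) h))
    · exact mul_pos (sub_pos.2 h) (sub_pos.2 (Real.log_lt_log (hq0 a ha.symm) h))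
  have hnonneg : ∀ a ∈ Finset.univ, 0 ≤ (p a - q a) * (Real.log (p a) - Real.log (q a)) := by
    intro a _
    by_cases h : p a = q a
    · simp [h]
    · exact (hterm a h).le
  ext a
  by_contra h
  exact (hterm a h).ne' ((Finset.sum_eq_zero_iff_of_nonneg hnonneg).1 hsum a
    (Finset.mem_univ a))

/-- Iterative scaling converges to a point of the toric variety above `y`. -/
theorem exists_tendsto_gis [Nonempty A] (hw : ∀ a, 0 < w a) {b : Fin d → ℝ} {t : ℝ}
    (hbt : IsNormalizing A b t) {y : Fin d → ℝ} (hy : y ∈ polytope A) :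
    ∃ r ∈ toricVariety A w, linProj (pts A) r = y ∧
      Tendsto (gis A w b t y) atTop (𝓝 r) ∧
      Tendsto (fun n => normalize (ipf A w b t y n)) atTop (𝓝 r) := by
  obtain ⟨q, hq, hq1, rfl⟩ := mem_polytope_iff.1 hy
  have hv := homog_pts_nonneg hbt
  have hs := fun a => sum_homog b t (pts A a)
  obtain ⟨r, hr, hrq, hlim⟩ := exists_tendsto_scalingIter hv hs hw hq hq1
  have hr1 : ∑ a, r a = 1 := by rw [← sum_linProj hs, hrq, sum_linProj hs, hq1]
  have hnorm := tendsto_normalize (hr1.symm ▸ one_ne_zero) hlim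
  rw [normalize_of_sum_eq_one hr1] at hnorm
  have hipf := hnorm.congr fun n => (normalize_scalingIter_tautProj hv hs hw hq hq1 n).symm
  have hsum : ∀ᶠ n in atTop,
      ∑ a, scalingIter (linProj fun a => homog b t (pts A a)) (fun a => homog b t (pts A a)) w
        (linProj (fun a => homog b t (pts A a)) q) n a ≠ 0 :=
    (tendsto_finsetSum _ fun a _ => tendsto_pi_nhds.1 hlim a).eventually_ne
      (hr1.symm ▸ one_ne_zero)
  refine ⟨r, ?_, linProj_eq_of_linProj_homog_eq hbt.1 hr1 hq1 hrq, ?_, ?_⟩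
  · refine isClosed_closure.mem_of_tendsto hnorm ?_
    filter_upwards [hsum] with n hn
    obtain ⟨θ, hθ, h⟩ := exists_scalingIter_eq_mul_monom hv (fun a => (hw a).le)
      (linProj_nonneg hv hq) n
    rw [funext h] at hn ⊢
    exact normalize_mul_monom_mem_toricVariety hbt hθ hn
  · rw [linProj_homog _ hq1] at hlim
    exact hlim
  · rw [linProj_homog _ hq1] at hipf
    exact hipf

/-- The tautological projection as a homeomorphism from the toric variety to the polytope. -/
theorem exists_homeomorph_tautProj [Nonempty A] (hw : ∀ a, 0 < w a) :
    ∃ π : toricVariety A w ≃ₜ polytope A,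
      ∀ p, (π p : Fin d → ℝ) = linProj (pts A) p := by
  have hX := toricVariety_subset_stdSimplex hw
  let f : toricVariety A w → polytope A := fun p =>
    ⟨linProj (pts A) p, mem_polytope_iff.2 ⟨p, (hX p.2).1, (hX p.2).2, rfl⟩⟩
  have hf : Continuous f :=
    ((continuous_linProj (pts A)).comp continuous_subtype_val).subtype_mk _
  have hinj : Function.Injective f := fun p q h =>
    Subtype.ext (eq_of_mem_toricVariety_of_linProj_eq hw p.2 q.2 (congrArg Subtype.val h))
  have hsurj : Function.Surjective f := fun y => by
    obtain ⟨b, t, hbt⟩ := exists_isNormalizing A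
    obtain ⟨r, hr, h, -⟩ := exists_tendsto_gis hw hbt y.2
    exact ⟨⟨r, hr⟩, Subtype.ext h⟩
  have : CompactSpace (toricVariety A w) :=
    isCompact_iff_compactSpace.1 ((isCompact_stdSimplex ℝ A).of_isClosed_subset isClosed_closure hX)
  exact ⟨Continuous.homeoOfEquivCompactToT2 (f := Equiv.ofBijective f ⟨hinj, hsurj⟩) hf,
    fun p => rfl⟩

end Variety

/-! ### Linear precision as a section of the projection. -/

section LinearPrecision

lemma hasLinearPrecision_iff {β : polytope A → A → ℝ} :
    HasLinearPrecision A β ↔ ∀ x, ∑ a, β x a = 1 ∧ linProj (pts A) (β x) = x := by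
  constructor
  · intro h x
    refine ⟨by simpa using (h (AffineMap.const ℝ _ 1) x).symm, funext fun i => ?_⟩
    have := h (LinearMap.proj (R := ℝ) (φ := fun _ : Fin d => ℝ) i).toAffineMap x
    rw [linProj_apply]
    exact this.symm
  · intro h Λ x
    obtain ⟨h1, h2⟩ := h x
    conv_lhs => rw [← h2, AffineMap.decomp Λ]
    conv_rhs => rw [AffineMap.decomp Λ]
    simp only [linProj, Pi.add_apply, map_sum, map_smul, smul_eq_mul, mul_add,
      Finset.sum_add_distrib, ← Finset.sum_mul, h1, one_mul]

end LinearPrecision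

end ToricPatch

end

/-! ### The main theorem. -/

theorem corollary4p3 {d : ℕ} (A : Finset (Fin d → ℤ))
    (hA : affineSpan ℝ (ToricPatch.polytope A) = ⊤)
    (w : A → ℝ) (hw : ∀ a, 0 < w a) :
    -- the tautological projection is a homeomorphism from `X_{A,w}` onto the polytope
    ∃ π : ToricPatch.toricVariety A w ≃ₜ ToricPatch.polytope A,
      (∀ p, (π p : Fin d → ℝ) = ToricPatch.tautProj (ToricPatch.pts A) p) ∧
      -- iterative proportional fitting computes its inverse
      (∃ b t, ToricPatch.IsNormalizing A b t) ∧
      (∀ b t, ToricPatch.IsNormalizing A b t → ∀ y : ToricPatch.polytope A,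
        Tendsto (fun n => ToricPatch.gis A w b t y n) atTop (𝓝 (π.symm y : A → ℝ)) ∧
        Tendsto (fun n => ToricPatch.normalize (ToricPatch.ipf A w b t y n)) atTop
          (𝓝 (π.symm y : A → ℝ))) ∧
      -- this inverse is the unique toric patch of shape `(A, w)` with linear precision
      (∀ β : ToricPatch.polytope A → A → ℝ,
        (ToricPatch.IsToricPatch A w β ∧ ToricPatch.HasLinearPrecision A β) ↔
          β = fun y => (π.symm y : A → ℝ)) ∧
      -- it is the unique reparametrization with linear precision of every proper toric patch
      (∀ β : ToricPatch.polytope A → A → ℝ,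
        ToricPatch.IsToricPatch A w β → ToricPatch.IsProper A β →
        ∃ ψ : ToricPatch.polytope A ≃ₜ ToricPatch.polytope A,
          (∀ ψ' : ToricPatch.polytope A ≃ₜ ToricPatch.polytope A,
            ToricPatch.HasLinearPrecision A
              (fun x => ToricPatch.normalize (β (ψ' x))) ↔ ψ' = ψ) ∧
          ∀ y, ToricPatch.normalize (β (ψ y)) = (π.symm y : A → ℝ)) := by
  have : Nonempty A := ToricPatch.nonempty_of_affineSpan_polytope hA
  have hX := ToricPatch.toricVariety_subset_stdSimplex hw
  obtain ⟨π, hπ⟩ := ToricPatch.exists_homeomorph_tautProj hw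
  have hsymm : ∀ y, ToricPatch.linProj (ToricPatch.pts A) (π.symm y : A → ℝ) = y := fun y => by
    rw [← hπ, π.apply_symm_apply]
  have hsum : ∀ y, ∑ a, (π.symm y : A → ℝ) a = 1 := fun y => (hX (π.symm y).2).2
  have huniq : ∀ {p : A → ℝ} {y : ToricPatch.polytope A}, p ∈ ToricPatch.toricVariety A w →
      ToricPatch.linProj (ToricPatch.pts A) p = y → p = π.symm y := fun {p y} hp h =>
    ToricPatch.eq_of_mem_toricVariety_of_linProj_eq hw hp (π.symm y).2 (h.trans (hsymm y).symm)
  refine ⟨π, fun p => ?_, ToricPatch.exists_isNormalizing A, fun b t hbt y => ?_,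
    fun β => ⟨fun ⟨hβ, hlin⟩ => ?_, ?_⟩, fun β hβ ⟨τ, hτ⟩ => ?_⟩
  · rw [hπ, ToricPatch.tautProj_of_sum_eq_one _ (hX p.2).2]
  · obtain ⟨r, hr, hry, h1, h2⟩ := ToricPatch.exists_tendsto_gis hw hbt y.2
    rw [← huniq hr hry]
    exact ⟨h1, h2⟩
  · rw [ToricPatch.hasLinearPrecision_iff] at hlin
    funext x
    refine huniq ?_ (hlin x).2
    rw [← hβ.image_eq]
    exact ⟨x, ToricPatch.normalize_of_sum_eq_one (hlin x).1⟩
  · rintro rfl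
    refine ⟨⟨⟨continuous_subtype_val.comp π.symm.continuous, fun x => (hX (π.symm x).2).1,
      fun x => ?_⟩, ?_⟩, ToricPatch.hasLinearPrecision_iff.2 fun x => ⟨hsum x, hsymm x⟩⟩
    · by_contra! h
      exact zero_ne_one ((Finset.sum_eq_zero fun a _ => h a).symm.trans (hsum x))
    · simp only [ToricPatch.normalize_of_sum_eq_one (hsum _)]
      ext p
      exact ⟨fun ⟨x, hx⟩ => hx ▸ (π.symm x).2,
        fun hp => ⟨π ⟨p, hp⟩, by simp only [π.symm_apply_apply]⟩⟩
  -- Both sides lie in the toric variety over `τ x`, so precomposition with `ψ` has linear precision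
  -- exactly when `τ ∘ ψ` is the identity.
  · have hβτ : ∀ x, ToricPatch.normalize (β x) = π.symm (τ x) := fun x =>
      huniq (hβ.image_eq ▸ mem_range_self x)
        ((ToricPatch.linProj_normalize _ _).trans (hτ x).symm)
    refine ⟨τ.symm, fun ψ => ?_, fun y => by rw [hβτ, τ.apply_symm_apply]⟩
    simp only [hβτ, ToricPatch.hasLinearPrecision_iff, hsum, hsymm, true_and, Subtype.coe_inj]
    exact ⟨fun h => Homeomorph.ext fun x => τ.injective (by rw [h, τ.apply_symm_apply]),
      fun h x => by rw [h, τ.apply_symm_apply]⟩
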